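/- Let $N\ge 2$, let $\Omega\subset\mathbb R^N$ be open and bounded, and let $p>1$ be a real number. Let $W^{1,p}_0(\Omega)$ be the closure of $C_c^\infty(\Omega)$ in $W^{1,p}(\Omega)$, with the norm $\|u\|_W=|\nabla u|_p$, where $|\cdot|_r$ is the norm of $L^r(\Omega)$, and let $X=W^{1,p}_0(\Omega)\cap L^\infty(\Omega)$, with the norm $\|u\|_X=\|u\|_W+|u|_\infty$ and with dual space $(X',\|\cdot\|_{X'})$. Let $A:\Omega\times\mathbb R\times\mathbb R^N\to\mathbb R$ be a $C^1$ Carathéodory function, i.e. $A(\cdot,t,\xi)$ is measurable for all $(t,\xi)$ and $A(x,\cdot,\cdot)$ is $C^1$ for a.e. $x\in\Omega$. Put $A_t=\partial A/\partial t$ and $a=(\partial A/\partial\xi_1,\dots,\partial A/\partial\xi_N)$, and suppose that there are positive continuous functions $\Phi_i,\phi_i:\mathbb R\to\mathbb R$, $i\in\{0,1,2\}$, such that for a.e. $x\in\Omega$ and all $(t,\xi)\in\mathbb R\times\mathbb R^N$ $$|A(x,t,\xi)|\le\Phi_0(t)+\phi_0(t)|\xi|^p,\quad |A_t(x,t,\xi)|\le\Phi_1(t)+\phi_1(t)|\xi|^p,\quad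 |a(x,t,\xi)|\le\Phi_2(t)+\phi_2(t)|\xi|^{p-1}.$$ Let $g:\Omega\times\mathbb R\to\mathbb R$ be a Carathéodory function, i.e. $g(\cdot,t)$ is measurable for all $t$ and $g(x,\cdot)$ is continuous for a.e. $x\in\Omega$, and suppose that there are $a_1,a_2>0$ and $q\ge1$ (with no upper bound on $q$) such that $|g(x,t)|\le a_1+a_2|t|^{q-1}$ for a.e. $x\in\Omega$ and all $t\in\mathbb R$. Put $G(x,t)=\int_0^t g(x,s)\,ds$. For $u,v\in X$ put $$J(u)=\int_\Omega A(x,u,\nabla u)\,dx-\int_\Omega G(x,u)\,dx,$$ $$\langle dJ(u),v\rangle=\int_\Omega\big(a(x,u,\nabla u)\cdot\nabla v+A_t(x,u,\nabla u)\,v\big)\,dx-\int_\Omega g(x,u)\,v\,dx .$$ Then all these integrals converge, and $dJ(u)\in X'$ for every $u\in X$. If $(u_n)_n\subset X$ and $u\in X$ are such that $\|u_n-u\|_W\to0$, $u_n\to u$ a.e. in $\Omega$, and $|u_n|_\infty\le M$ for all $n$ with some $M>0$, then $J(u_n)\to J(u)$ and $\|dJ(u_n)-dJ(u)\|_{X'}\to0$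 as $n\to\infty$. Moreover, $J$ is a $C^1$ functional on $X$ whose Fréchet differential at each $u\in X$ is $dJ(u)$. -/

import Mathlib

open MeasureTheory Filter Topology
open scoped ENNReal ContDiff

noncomputable section

/-- The Euclidean space `ℝ^N`. -/
abbrev Euc (N : ℕ) : Type := EuclideanSpace ℝ (Fin N)

/-- For a real exponent `p > 1` the spaces `L^p` are normed spaces. -/
instance factOneLeOfReal (p : ℝ) [hp : Fact (1 < p)] : Fact (1 ≤ ENNReal.ofReal p) :=
  ⟨ENNReal.one_le_ofReal.mpr hp.out.le⟩

/-- `Lebesgue measure on Ω`, as a measure on `ℝ^N`. -/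
abbrev volOn {N : ℕ} (Ω : Set (Euc N)) : Measure (Euc N) := volume.restrict Ω

/-- `φ ∈ C_c^∞(Ω)`. -/
structure IsTestFunction {N : ℕ} (Ω : Set (Euc N)) (φ : Euc N → ℝ) : Prop where
  smooth : ContDiff ℝ ∞ φ
  compact : HasCompactSupport φ
  support : tsupport φ ⊆ Ω

/-- `F` is the weak gradient of `u` in `Ω`. -/
def IsWeakGradient {N : ℕ} (Ω : Set (Euc N)) (u : Euc N → ℝ) (F : Euc N → Euc N) : Prop :=
  ∀ φ : Euc N → ℝ, IsTestFunction Ω φ →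
    ∫ x, u x • gradient φ x ∂(volOn Ω) = - ∫ x, φ x • F x ∂(volOn Ω)

section helpers

variable {N : ℕ} {Ω : Set (Euc N)}

theorem gradient_add_of_smooth {φ ψ : Euc N → ℝ} (hφ : ContDiff ℝ ∞ φ) (hψ : ContDiff ℝ ∞ ψ)
    (x : Euc N) :
    gradient (fun y => φ y + ψ y) x = gradient φ x + gradient ψ x := by
  have h1 : DifferentiableAt ℝ φ x := hφ.differentiable (by simp) x
  have h2 : DifferentiableAt ℝ ψ x := hψ.differentiable (by simp) x
  have h : fderiv ℝ (fun y => φ y + ψ y) x = fderiv ℝ φ x + fderiv ℝ ψ x := fderiv_add h1 h2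
  simp only [gradient, h, map_add]

theorem gradient_smul_of_smooth {φ : Euc N → ℝ} (hφ : ContDiff ℝ ∞ φ) (c : ℝ) (x : Euc N) :
    gradient (fun y => c * φ y) x = c • gradient φ x := by
  have h1 : DifferentiableAt ℝ φ x := hφ.differentiable (by simp) x
  have h : fderiv ℝ (fun y => c * φ y) x = c • fderiv ℝ φ x := fderiv_const_mul h1 c
  simp only [gradient, h, map_smul]

theorem IsTestFunction.continuous_gradient {φ : Euc N → ℝ} (hφ : IsTestFunction Ω φ) :
    Continuous (gradient φ) :=
  (InnerProductSpace.toDual ℝ (Euc N)).symm.continuous.comp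
    (hφ.smooth.continuous_fderiv (by simp))

theorem IsTestFunction.compact_gradient {φ : Euc N → ℝ} (hφ : IsTestFunction Ω φ) :
    HasCompactSupport (gradient φ) :=
  (hφ.compact.fderiv (𝕜 := ℝ)).comp_left
    (g := (InnerProductSpace.toDual ℝ (Euc N)).symm) (map_zero _)

theorem IsTestFunction.integrable_smul_gradient {φ : Euc N → ℝ} (hφ : IsTestFunction Ω φ)
    {p : ℝ≥0∞} (hp : 1 ≤ p) {u : Euc N → ℝ} (hu : MemLp u p (volOn Ω)) :
    Integrable (fun x => u x • gradient φ x) (volOn Ω) :=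
  (hu.locallyIntegrable hp).integrable_smul_right_of_hasCompactSupport
    hφ.continuous_gradient hφ.compact_gradient

theorem IsTestFunction.integrable_smul {φ : Euc N → ℝ} (hφ : IsTestFunction Ω φ)
    {p : ℝ≥0∞} (hp : 1 ≤ p) {F : Euc N → Euc N} (hF : MemLp F p (volOn Ω)) :
    Integrable (fun x => φ x • F x) (volOn Ω) :=
  (hF.locallyIntegrable hp).integrable_smul_left_of_hasCompactSupport
    hφ.smooth.continuous hφ.compact

end helpers

/-- The Sobolev space `W^{1,p}(Ω)`: a function is represented by the pair `(u, ∇u)` of its class in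
`L^p(Ω)` and its weak gradient in `L^p(Ω; ℝ^N)` (which is determined by `u`). -/
def sobolevW1 {N : ℕ} (Ω : Set (Euc N)) (p : ℝ) [Fact (1 < p)] :
    Submodule ℝ (Lp ℝ (ENNReal.ofReal p) (volOn Ω) × Lp (Euc N) (ENNReal.ofReal p) (volOn Ω)) where
  carrier := {z | IsWeakGradient Ω z.1 z.2}
  zero_mem' := by
    intro φ _
    rw [integral_eq_zero_of_ae, integral_eq_zero_of_ae, neg_zero]
    · filter_upwards [Lp.coeFn_zero (Euc N) (ENNReal.ofReal p) (volOn Ω)] with x hx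
      rw [Prod.snd_zero, hx]
      simp
    · filter_upwards [Lp.coeFn_zero ℝ (ENNReal.ofReal p) (volOn Ω)] with x hx
      rw [Prod.fst_zero, hx]
      simp
  add_mem' := by
    intro z w hz hw φ hφ
    have h1 : (1 : ℝ≥0∞) ≤ ENNReal.ofReal p := Fact.out
    have e1 : ∫ x, (z + w).1 x • gradient φ x ∂(volOn Ω)
        = ∫ x, (z.1 x • gradient φ x + w.1 x • gradient φ x) ∂(volOn Ω) := by
      apply integral_congr_ae
      filter_upwards [Lp.coeFn_add z.1 w.1] with x hx
      rw [Prod.fst_add, hx, Pi.add_apply, add_smul]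
    have e2 : ∫ x, φ x • (z + w).2 x ∂(volOn Ω)
        = ∫ x, (φ x • z.2 x + φ x • w.2 x) ∂(volOn Ω) := by
      apply integral_congr_ae
      filter_upwards [Lp.coeFn_add z.2 w.2] with x hx
      rw [Prod.snd_add, hx, Pi.add_apply, smul_add]
    rw [e1, e2, integral_add (hφ.integrable_smul_gradient h1 (Lp.memLp z.1))
        (hφ.integrable_smul_gradient h1 (Lp.memLp w.1)),
      integral_add (hφ.integrable_smul h1 (Lp.memLp z.2)) (hφ.integrable_smul h1 (Lp.memLp w.2)),
      hz φ hφ, hw φ hφ, neg_add]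
  smul_mem' := by
    intro c z hz φ hφ
    have e1 : ∫ x, (c • z).1 x • gradient φ x ∂(volOn Ω)
        = ∫ x, c • (z.1 x • gradient φ x) ∂(volOn Ω) := by
      apply integral_congr_ae
      filter_upwards [Lp.coeFn_smul c z.1] with x hx
      rw [Prod.smul_fst, hx, Pi.smul_apply, smul_assoc]
    have e2 : ∫ x, φ x • (c • z).2 x ∂(volOn Ω) = ∫ x, c • (φ x • z.2 x) ∂(volOn Ω) := by
      apply integral_congr_ae
      filter_upwards [Lp.coeFn_smul c z.2] with x hx
      rw [Prod.smul_snd, hx, Pi.smul_apply, smul_comm]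
    rw [e1, e2, integral_smul, integral_smul, hz φ hφ, smul_neg]

/-- The test functions `C_c^∞(Ω)`, as pairs `(φ, ∇φ)`. -/
def testSpace {N : ℕ} (Ω : Set (Euc N)) (p : ℝ) [Fact (1 < p)] :
    Submodule ℝ (Lp ℝ (ENNReal.ofReal p) (volOn Ω) × Lp (Euc N) (ENNReal.ofReal p) (volOn Ω)) where
  carrier := {z | ∃ φ : Euc N → ℝ, IsTestFunction Ω φ ∧
    z.1 =ᵐ[volOn Ω] φ ∧ z.2 =ᵐ[volOn Ω] gradient φ}
  zero_mem' := by
    refine ⟨fun _ => 0, ⟨contDiff_const, HasCompactSupport.zero, by simp [tsupport]⟩, ?_, ?_⟩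
    · filter_upwards [Lp.coeFn_zero ℝ (ENNReal.ofReal p) (volOn Ω)] with x hx
      simpa using hx
    · filter_upwards [Lp.coeFn_zero (Euc N) (ENNReal.ofReal p) (volOn Ω)] with x hx
      have : gradient (fun _ : Euc N => (0 : ℝ)) x = 0 := by simp [gradient]
      simpa [this] using hx
  add_mem' := by
    rintro z w ⟨φ, hφ, h1, h2⟩ ⟨ψ, hψ, h3, h4⟩
    refine ⟨fun x => φ x + ψ x, ⟨hφ.smooth.add hψ.smooth, hφ.compact.add hψ.compact,
      (tsupport_add φ ψ).trans (Set.union_subset hφ.support hψ.support)⟩, ?_, ?_⟩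
    · filter_upwards [Lp.coeFn_add z.1 w.1, h1, h3] with x hx hx1 hx3
      rw [Prod.fst_add, hx, Pi.add_apply, hx1, hx3]
    · filter_upwards [Lp.coeFn_add z.2 w.2, h2, h4] with x hx hx2 hx4
      rw [Prod.snd_add, hx, Pi.add_apply, hx2, hx4, gradient_add_of_smooth hφ.smooth hψ.smooth]
  smul_mem' := by
    rintro c z ⟨φ, hφ, h1, h2⟩
    refine ⟨fun x => c * φ x, ⟨contDiff_const.mul hφ.smooth, hφ.compact.mul_left,
      (tsupport_mul_subset_right (f := fun _ => c) (g := φ)).trans hφ.support⟩, ?_, ?_⟩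
    · filter_upwards [Lp.coeFn_smul c z.1, h1] with x hx hx1
      rw [Prod.smul_fst, hx, Pi.smul_apply, hx1, smul_eq_mul]
    · filter_upwards [Lp.coeFn_smul c z.2, h2] with x hx hx2
      rw [Prod.smul_snd, hx, Pi.smul_apply, hx2, gradient_smul_of_smooth hφ.smooth]

/-- `W^{1,p}_0(Ω)`: the closure of `C_c^∞(Ω)` in `W^{1,p}(Ω)`. -/
def sobolevW10 {N : ℕ} (Ω : Set (Euc N)) (p : ℝ) [Fact (1 < p)] :
    Submodule ℝ (Lp ℝ (ENNReal.ofReal p) (volOn Ω) × Lp (Euc N) (ENNReal.ofReal p) (volOn Ω)) :=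
  sobolevW1 Ω p ⊓ (testSpace Ω p).topologicalClosure

/-- The space `X = W^{1,p}_0(Ω) ∩ L^∞(Ω)`. An element `u` is represented by the pair `(∇u, u)` in
`L^p(Ω; ℝ^N) × L^∞(Ω)`; the norm inherited from the `ℓ^1`-product is
`‖u‖_X = |∇u|_p + |u|_∞`. -/
def spaceX {N : ℕ} (Ω : Set (Euc N)) (p : ℝ) [Fact (1 < p)] :
    Submodule ℝ (WithLp 1 (Lp (Euc N) (ENNReal.ofReal p) (volOn Ω) × Lp ℝ ∞ (volOn Ω))) where
  carrier := {w | ∃ z ∈ sobolevW10 Ω p, z.1 =ᵐ[volOn Ω] w.snd ∧ z.2 = w.fst}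
  zero_mem' := by
    refine ⟨0, Submodule.zero_mem _, ?_, rfl⟩
    filter_upwards [Lp.coeFn_zero ℝ (ENNReal.ofReal p) (volOn Ω), Lp.coeFn_zero ℝ ∞ (volOn Ω)]
      with x h1 h2
    rw [Prod.fst_zero, WithLp.zero_snd, h1, h2]
  add_mem' := by
    rintro w w' ⟨z, hz, h1, h2⟩ ⟨z', hz', h1', h2'⟩
    refine ⟨z + z', Submodule.add_mem _ hz hz', ?_, by simp [h2, h2']⟩
    filter_upwards [Lp.coeFn_add z.1 z'.1, Lp.coeFn_add w.snd w'.snd, h1, h1'] with x a b c d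
    rw [Prod.fst_add, WithLp.add_snd, a, b, Pi.add_apply, Pi.add_apply, c, d]
  smul_mem' := by
    rintro r w ⟨z, hz, h1, h2⟩
    refine ⟨r • z, Submodule.smul_mem _ r hz, ?_, by simp [h2]⟩
    filter_upwards [Lp.coeFn_smul r z.1, Lp.coeFn_smul r w.snd, h1] with x a b c
    rw [Prod.smul_fst, WithLp.smul_snd, a, b, Pi.smul_apply, Pi.smul_apply, c]

section elements

variable {N : ℕ} {Ω : Set (Euc N)} {p : ℝ} [Fact (1 < p)]

/-- The class of `u ∈ X` in `L^∞(Ω)`. -/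
def spaceX.val (u : spaceX Ω p) : Lp ℝ ∞ (volOn Ω) := u.1.snd

/-- The weak gradient `∇u ∈ L^p(Ω; ℝ^N)` of `u ∈ X`. -/
def spaceX.grad (u : spaceX Ω p) : Lp (Euc N) (ENNReal.ofReal p) (volOn Ω) :=
  u.1.fst

/-- `‖u‖_W = |∇u|_p`. -/
def normW (u : spaceX Ω p) : ℝ := ‖spaceX.grad u‖

/-- `|u|_∞`, the essential supremum of `|u|` over `Ω`. -/
def normInfty (u : spaceX Ω p) : ℝ := ‖spaceX.val u‖

theorem norm_spaceX (u : spaceX Ω p) : ‖u‖ = normW u + normInfty u :=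
  WithLp.prod_norm_eq_of_L1 u.1

end elements

/-- `C^1` Carathéodory functions `A(x, t, ξ)`; measurability is with respect to the Lebesgue
measurable sets of `Ω`. -/
structure IsC1Caratheodory {N : ℕ} (Ω : Set (Euc N)) (A : Euc N → ℝ → Euc N → ℝ) : Prop where
  measurable : ∀ (t : ℝ) (ξ : Euc N), AEMeasurable (fun x => A x t ξ) (volOn Ω)
  contDiff : ∀ᵐ x ∂(volOn Ω), ContDiff ℝ 1 (fun z : ℝ × Euc N => A x z.1 z.2)

/-- Carathéodory functions `g(x, t)`. -/
structure IsCaratheodory {N : ℕ} (Ω : Set (Euc N)) (g : Euc N → ℝ → ℝ) : Prop where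
  measurable : ∀ t : ℝ, AEMeasurable (fun x => g x t) (volOn Ω)
  continuous : ∀ᵐ x ∂(volOn Ω), Continuous (g x)

/-- `A_t = ∂A/∂t`. -/
def partialT {N : ℕ} (A : Euc N → ℝ → Euc N → ℝ) (x : Euc N) (t : ℝ) (ξ : Euc N) : ℝ :=
  deriv (fun s => A x s ξ) t

/-- `a = ∇_ξ A = (∂A/∂ξ_1, …, ∂A/∂ξ_N)`. -/
def gradXi {N : ℕ} (A : Euc N → ℝ → Euc N → ℝ) (x : Euc N) (t : ℝ) (ξ : Euc N) : Euc N :=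
  gradient (fun η => A x t η) ξ

/-- `G(x, t) = ∫_0^t g(x, s) ds`. -/
def primitiveG {N : ℕ} (g : Euc N → ℝ → ℝ) (x : Euc N) (t : ℝ) : ℝ :=
  ∫ s in (0 : ℝ)..t, g x s

/-- `J(u) = ∫_Ω A(x, u, ∇u) dx - ∫_Ω G(x, u) dx` on `X`. -/
def functionalJ {N : ℕ} {Ω : Set (Euc N)} {p : ℝ} [Fact (1 < p)]
    (A : Euc N → ℝ → Euc N → ℝ) (g : Euc N → ℝ → ℝ) (u : spaceX Ω p) : ℝ :=
  ∫ x, A x (spaceX.val u x) (spaceX.grad u x) ∂(volOn Ω)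
    - ∫ x, primitiveG g x (spaceX.val u x) ∂(volOn Ω)

/-- `⟨dJ(u), v⟩ = ∫_Ω (a(x, u, ∇u) · ∇v + A_t(x, u, ∇u) v) dx - ∫_Ω g(x, u) v dx`. -/
def differentialJ {N : ℕ} {Ω : Set (Euc N)} {p : ℝ} [Fact (1 < p)]
    (A : Euc N → ℝ → Euc N → ℝ) (g : Euc N → ℝ → ℝ) (u v : spaceX Ω p) : ℝ :=
  ∫ x, (inner ℝ (gradXi A x (spaceX.val u x) (spaceX.grad u x)) (spaceX.grad v x)
      + partialT A x (spaceX.val u x) (spaceX.grad u x) * spaceX.val v x) ∂(volOn Ω)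
    - ∫ x, g x (spaceX.val u x) * spaceX.val v x ∂(volOn Ω)

end

/-! The two integrals of `J` are merged into one with density H = A - G, whose partial derivatives
are B = A_t - g in t and a = ∇_ξ A in ξ. On a set bounded in L^∞ the values of u stay in a compact
interval, where the continuous coefficients Φ_i, φ_i and any power of |t| are bounded. Hence |H|,
|B| and |a|^{p/(p-1)} are all at most K(1 + |ξ|^p), whatever q is (`HasGrowth`).

This growth makes u ↦ H, B, a at (x, u, ∇u) continuous into L^1, L^1 and L^{p/(p-1)} along sequences
bounded in L^∞, convergent a.e. and convergent in W (`HasGrowth.tendsto_eLpNorm`). Along a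
subsequence the gradients converge a.e., and dominated convergence applies with a majorant that
itself converges in L^1. By Hölder, a pair of densities in L^{p/(p-1)} × L^1 acts continuously on X,
with a continuous dependence in the norm of X' (`continuous_pairing`). Both convergence claims
follow. Convergence in X is a special case, so dJ is continuous on X.

For differentiability, growth and Young's inequality permit differentiation under the integral along
every line (`hasDerivAt_integral_line`). The mean value theorem and the continuity of dJ then turn
these directional derivatives into a Fréchet derivative (`hasFDerivAt_of_hasDerivAt_line`). -/

/-! ### Carathéodory maps and dominated convergence -/

/-- Functions `F(x, z)` that are measurable in `x` and, for almost every `x`, continuous in `z`. -/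
structure CaratheodoryMap {α Z β : Type*} [MeasurableSpace α] [TopologicalSpace Z]
    [TopologicalSpace β] (μ : Measure α) (F : α → Z → β) : Prop where
  measurable : ∀ z, AEStronglyMeasurable (fun x => F x z) μ
  continuous : ∀ᵐ x ∂μ, Continuous (F x)

namespace CaratheodoryMap

variable {α Z β : Type*} [MeasurableSpace α] {μ : Measure α}
  [TopologicalSpace Z] [TopologicalSpace β] [TopologicalSpace.PseudoMetrizableSpace β]
  {F : α → Z → β}

/-- On each of the finitely many fibres of `f` the composition is a section of `F` at a fixed point.
-/
theorem comp_simpleFunc (hF : CaratheodoryMap μ F) (f : SimpleFunc α Z) :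
    AEStronglyMeasurable (fun x => F x (f x)) μ := by
  have hU : (⋃ z : f.range, f ⁻¹' {(z : Z)}) = Set.univ := by
    ext x
    simp
  rw [← Measure.restrict_univ (μ := μ), ← hU]
  refine aestronglyMeasurable_iUnion_iff.2 fun z => ?_
  refine ((hF.measurable z).mono_measure Measure.restrict_le_self).congr ?_
  filter_upwards [ae_restrict_mem (f.measurableSet_preimage {(z : Z)})] with x hx
  rw [show f x = z from hx]

/-- Simple functions approximate a strongly measurable representative of `w`, and continuity in the
second variable carries the approximation through `F`. -/
theorem comp_aestronglyMeasurable (hF : CaratheodoryMap μ F) {w : α → Z}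
    (hw : AEStronglyMeasurable w μ) : AEStronglyMeasurable (fun x => F x (w x)) μ := by
  have h1 : AEStronglyMeasurable (fun x => F x (hw.mk w x)) μ := by
    refine aestronglyMeasurable_of_tendsto_ae atTop
      (f := fun n x => F x (hw.stronglyMeasurable_mk.approx n x))
      (fun n => hF.comp_simpleFunc _) ?_
    filter_upwards [hF.continuous] with x hx
    exact (hx.tendsto _).comp (hw.stronglyMeasurable_mk.tendsto_approx x)
  refine h1.congr ?_
  filter_upwards [hw.ae_eq_mk] with x hx
  rw [hx]

end CaratheodoryMap

/-- Convergence to zero of integrals under a dominating function that converges in `L¹`. -/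
theorem tendsto_lintegral_zero_of_le_add {α : Type*} [MeasurableSpace α] {μ : Measure α}
    {D r : ℕ → α → ℝ≥0∞} {b : α → ℝ≥0∞} (hD : ∀ n, AEMeasurable (D n) μ)
    (hr : ∀ n, AEMeasurable (r n) μ) (hb : AEMeasurable b μ) (hbf : ∫⁻ x, b x ∂μ ≠ ⊤)
    (hle : ∀ n, ∀ᵐ x ∂μ, D n x ≤ b x + r n x)
    (hlim : ∀ᵐ x ∂μ, Tendsto (fun n => D n x) atTop (𝓝 0))
    (hr0 : Tendsto (fun n => ∫⁻ x, r n x ∂μ) atTop (𝓝 0)) :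
    Tendsto (fun n => ∫⁻ x, D n x ∂μ) atTop (𝓝 0) := by
  -- `D n` is at most min(`D n`, `b`) + `r n`: the first term is dominated by `b`, the second
  -- vanishes in L^1.
  have h1 : Tendsto (fun n => ∫⁻ x, min (D n x) (b x) ∂μ) atTop (𝓝 (∫⁻ _, 0 ∂μ)) := by
    refine tendsto_lintegral_of_dominated_convergence' b (fun n => (hD n).min hb)
      (fun n => Eventually.of_forall fun x => min_le_right _ _) hbf ?_
    filter_upwards [hlim] with x hx
    exact tendsto_of_tendsto_of_tendsto_of_le_of_le tendsto_const_nhds hx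
      (fun _ => zero_le) (fun _ => min_le_left _ _)
  rw [lintegral_zero] at h1
  have h2 := h1.add hr0
  rw [add_zero] at h2
  refine tendsto_of_tendsto_of_tendsto_of_le_of_le tendsto_const_nhds h2 (fun _ => zero_le) ?_
  intro n
  simp only
  rw [← lintegral_add_right' _ (hr n)]
  refine lintegral_mono_ae ?_
  filter_upwards [hle n] with x hx
  rcases le_total (D n x) (b x) with h | h
  · rw [min_eq_left h]; exact le_self_add
  · rwa [min_eq_right h]

/-! ### Nemytskii operators under p-growth -/

section Nemytskii

variable {α E E' : Type*} [MeasurableSpace α] {μ : Measure α}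
  [NormedAddCommGroup E] [NormedAddCommGroup E'] {F : α → ℝ × E → E'}

/-- `|F(x, t, ξ)|^r` grows at most like `|ξ|^p`, locally uniformly in `t`. -/
def HasGrowth (μ : Measure α) (F : α → ℝ × E → E') (p r : ℝ) : Prop :=
  ∀ M : ℝ, ∃ K : ℝ, 0 ≤ K ∧ ∀ᵐ x ∂μ, ∀ (t : ℝ) (ξ : E), |t| ≤ M →
    ‖F x (t, ξ)‖ ^ r ≤ K * (1 + ‖ξ‖ ^ p)

/-- Comparison with 2 max(a, b) costs a crude constant but treats all exponents s ≥ 0 at once. -/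
theorem real_add_rpow_le {a b s : ℝ} (ha : 0 ≤ a) (hb : 0 ≤ b) (hs : 0 ≤ s) :
    (a + b) ^ s ≤ 2 ^ s * (a ^ s + b ^ s) := by
  have h : (a + b) ^ s ≤ (2 * max a b) ^ s := by
    refine Real.rpow_le_rpow (by positivity) ?_ hs
    linarith [le_max_left a b, le_max_right a b]
  refine h.trans ?_
  rw [Real.mul_rpow (by norm_num) (le_max_of_le_left ha)]
  gcongr
  rcases max_choice a b with h | h <;> rw [h]
  · linarith [Real.rpow_nonneg hb s]
  · linarith [Real.rpow_nonneg ha s]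

theorem eLpNorm_ofReal_eq_lintegral {f : α → E'} {r : ℝ} (hr : 0 < r) :
    eLpNorm f (ENNReal.ofReal r) μ = (∫⁻ x, ENNReal.ofReal (‖f x‖ ^ r) ∂μ) ^ (1 / r) := by
  rw [eLpNorm_eq_lintegral_rpow_enorm_toReal (by simpa using hr) ENNReal.ofReal_ne_top,
    ENNReal.toReal_ofReal hr.le]
  congr 1
  refine lintegral_congr fun x => ?_
  rw [← ofReal_norm, ENNReal.ofReal_rpow_of_nonneg (norm_nonneg _) hr.le]

/-- Growth bounds and majorants concern r-th powers, so limits are computed there and carried back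
to norms. -/
theorem tendsto_eLpNorm_ofReal_iff {f : ℕ → α → E'} {r : ℝ} (hr : 0 < r) :
    Tendsto (fun n => eLpNorm (f n) (ENNReal.ofReal r) μ) atTop (𝓝 0) ↔
      Tendsto (fun n => ∫⁻ x, ENNReal.ofReal (‖f n x‖ ^ r) ∂μ) atTop (𝓝 0) := by
  simp_rw [eLpNorm_ofReal_eq_lintegral (μ := μ) hr]
  constructor
  · intro h
    have := (ENNReal.continuous_rpow_const (y := r)).tendsto 0 |>.comp h
    rw [ENNReal.zero_rpow_of_pos hr] at this
    refine this.congr fun n => ?_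
    simp only [Function.comp_apply]
    rw [← ENNReal.rpow_mul, one_div, inv_mul_cancel₀ hr.ne', ENNReal.rpow_one]
  · intro h
    have := (ENNReal.continuous_rpow_const (y := 1 / r)).tendsto 0 |>.comp h
    rwa [ENNReal.zero_rpow_of_pos (by positivity)] at this

variable [IsFiniteMeasure μ]

theorem integrable_one_add_norm_rpow {p : ℝ} (hp : 0 < p) {ξ : α → E}
    (hξ : MemLp ξ (ENNReal.ofReal p) μ) (K : ℝ) :
    Integrable (fun x => K * (1 + ‖ξ x‖ ^ p)) μ := by
  have := hξ.integrable_norm_rpow (by simpa using hp) ENNReal.ofReal_ne_top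
  rw [ENNReal.toReal_ofReal hp.le] at this
  exact ((integrable_const _).add this).const_mul _

variable {p r : ℝ}

theorem HasGrowth.memLp (hF : CaratheodoryMap μ F) (hp : 0 < p) (hr : 0 < r)
    (hgr : HasGrowth μ F p r) {t : α → ℝ} {ξ : α → E} (ht : AEStronglyMeasurable t μ) {M : ℝ}
    (hM : ∀ᵐ x ∂μ, |t x| ≤ M) (hξ : MemLp ξ (ENNReal.ofReal p) μ) :
    MemLp (fun x => F x (t x, ξ x)) (ENNReal.ofReal r) μ := by
  obtain ⟨K, -, hK⟩ := hgr M
  have hm := hF.comp_aestronglyMeasurable (ht.prodMk hξ.1)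
  rw [← integrable_norm_rpow_iff hm (by simpa using hr) ENNReal.ofReal_ne_top,
    ENNReal.toReal_ofReal hr.le]
  refine (integrable_one_add_norm_rpow hp hξ K).mono'
    (hm.norm.aemeasurable.pow_const r).aestronglyMeasurable ?_
  filter_upwards [hK, hM] with x h1 h2
  rw [Real.norm_of_nonneg (by positivity)]
  exact h1 _ _ h2

/-- The integrand is at most C(1 + |ξ₀|^p) + C|ξ_n - ξ₀|^p, a fixed integrable function plus a term
vanishing in L^1, so `tendsto_lintegral_zero_of_le_add` applies. -/
theorem HasGrowth.tendsto_lintegral_of_ae (hF : CaratheodoryMap μ F) (hp : 0 < p) (hr : 0 < r)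
    (hgr : HasGrowth μ F p r) {t : ℕ → α → ℝ} {ξ : ℕ → α → E} {t₀ : α → ℝ} {ξ₀ : α → E}
    (ht : ∀ n, AEStronglyMeasurable (t n) μ) (ht₀ : AEStronglyMeasurable t₀ μ) {M : ℝ}
    (hM : ∀ n, ∀ᵐ x ∂μ, |t n x| ≤ M) (hM₀ : ∀ᵐ x ∂μ, |t₀ x| ≤ M)
    (hξ : ∀ n, MemLp (ξ n) (ENNReal.ofReal p) μ) (hξ₀ : MemLp ξ₀ (ENNReal.ofReal p) μ)
    (htt : ∀ᵐ x ∂μ, Tendsto (fun n => t n x) atTop (𝓝 (t₀ x)))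
    (hξξ : ∀ᵐ x ∂μ, Tendsto (fun n => ξ n x) atTop (𝓝 (ξ₀ x)))
    (hξp : Tendsto (fun n => ∫⁻ x, ENNReal.ofReal (‖ξ n x - ξ₀ x‖ ^ p) ∂μ) atTop (𝓝 0)) :
    Tendsto (fun n => ∫⁻ x, ENNReal.ofReal
      (‖F x (t n x, ξ n x) - F x (t₀ x, ξ₀ x)‖ ^ r) ∂μ) atTop (𝓝 0) := by
  obtain ⟨K, hK0, hK⟩ := hgr M
  -- The factor 2^r K comes from splitting the difference of the two values of `F`; 2 + 2^p absorbs
  -- 2 + |ξ_n|^p + |ξ₀|^p once ξ_n is written as (ξ_n - ξ₀) + ξ₀.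
  set C : ℝ := 2 ^ r * K * (2 + 2 ^ p) with hC
  have hC0 : 0 ≤ C := by positivity
  have hm₀ := hF.comp_aestronglyMeasurable (ht₀.prodMk hξ₀.1)
  have hm := fun n => hF.comp_aestronglyMeasurable ((ht n).prodMk (hξ n).1)
  refine tendsto_lintegral_zero_of_le_add
    (b := fun x => ENNReal.ofReal (C * (1 + ‖ξ₀ x‖ ^ p)))
    (r := fun n x => ENNReal.ofReal C * ENNReal.ofReal (‖ξ n x - ξ₀ x‖ ^ p))
    (fun n => (((hm n).sub hm₀).norm.aemeasurable.pow_const r).ennreal_ofReal)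
    (fun n => ((((hξ n).1.sub hξ₀.1).norm.aemeasurable.pow_const p).ennreal_ofReal).const_mul _)
    (integrable_one_add_norm_rpow hp hξ₀ C).1.aemeasurable.ennreal_ofReal ?_ ?_ ?_ ?_
  · exact (integrable_one_add_norm_rpow hp hξ₀ C).lintegral_lt_top.ne
  · intro n
    filter_upwards [hK, hM n, hM₀] with x h1 h2 h3
    rw [← ENNReal.ofReal_mul hC0, ← ENNReal.ofReal_add (by positivity) (by positivity)]
    refine ENNReal.ofReal_le_ofReal ?_
    have e1 : ‖F x (t n x, ξ n x) - F x (t₀ x, ξ₀ x)‖ ^ r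
        ≤ 2 ^ r * (K * (1 + ‖ξ n x‖ ^ p) + K * (1 + ‖ξ₀ x‖ ^ p)) := by
      refine (Real.rpow_le_rpow (norm_nonneg _) (norm_sub_le _ _) hr.le).trans ?_
      refine (real_add_rpow_le (norm_nonneg _) (norm_nonneg _) hr.le).trans ?_
      gcongr
      · exact h1 _ _ h2
      · exact h1 _ _ h3
    have e2 : ‖ξ n x‖ ^ p ≤ 2 ^ p * (‖ξ n x - ξ₀ x‖ ^ p + ‖ξ₀ x‖ ^ p) := by
      refine (Real.rpow_le_rpow (norm_nonneg _) ?_ hp.le).trans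
        (real_add_rpow_le (norm_nonneg _) (norm_nonneg _) hp.le)
      simpa using norm_add_le (ξ n x - ξ₀ x) (ξ₀ x)
    have e3 : 0 ≤ ‖ξ n x - ξ₀ x‖ ^ p := by positivity
    have e4 : 0 ≤ ‖ξ₀ x‖ ^ p := by positivity
    have e5 : (1 : ℝ) ≤ 2 ^ p := Real.one_le_rpow (by norm_num) hp.le
    calc _ ≤ _ := e1
      _ = 2 ^ r * K * (2 + ‖ξ n x‖ ^ p + ‖ξ₀ x‖ ^ p) := by ring
      _ ≤ 2 ^ r * K * (2 + 2 ^ p * (‖ξ n x - ξ₀ x‖ ^ p + ‖ξ₀ x‖ ^ p) + ‖ξ₀ x‖ ^ p) := by gcongr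
      _ ≤ 2 ^ r * K * ((2 + 2 ^ p) * (1 + ‖ξ₀ x‖ ^ p) + (2 + 2 ^ p) * ‖ξ n x - ξ₀ x‖ ^ p) := by
        refine mul_le_mul_of_nonneg_left ?_ (by positivity)
        nlinarith
      _ = _ := by rw [hC]; ring
  · filter_upwards [hF.continuous, htt, hξξ] with x h1 h2 h3
    have h4 : Tendsto (fun n => F x (t n x, ξ n x)) atTop (𝓝 (F x (t₀ x, ξ₀ x))) :=
      (h1.tendsto _).comp (h2.prodMk_nhds h3)
    have h5 := ((tendsto_iff_norm_sub_tendsto_zero.1 h4).rpow_const (Or.inr hr.le))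
    rw [Real.zero_rpow hr.ne'] at h5
    simpa using ENNReal.tendsto_ofReal h5
  · have := ENNReal.Tendsto.const_mul hξp (Or.inr (ENNReal.ofReal_ne_top (r := C)))
    rw [mul_zero] at this
    refine this.congr fun n => ?_
    rw [lintegral_const_mul' _ _ ENNReal.ofReal_ne_top]

/-- Continuity of Nemytskii operators along sequences `(t n, ξ n)` with `t n` bounded in `L^∞` and
convergent almost everywhere, and `ξ n` convergent in `L^p`. -/
theorem HasGrowth.tendsto_eLpNorm (hF : CaratheodoryMap μ F) (hp : 0 < p) (hr : 0 < r)
    (hgr : HasGrowth μ F p r) {t : ℕ → α → ℝ} {ξ : ℕ → α → E} {t₀ : α → ℝ} {ξ₀ : α → E}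
    (ht : ∀ n, AEStronglyMeasurable (t n) μ) (ht₀ : AEStronglyMeasurable t₀ μ) {M : ℝ}
    (hM : ∀ n, ∀ᵐ x ∂μ, |t n x| ≤ M)
    (hξ : ∀ n, MemLp (ξ n) (ENNReal.ofReal p) μ) (hξ₀ : MemLp ξ₀ (ENNReal.ofReal p) μ)
    (htt : ∀ᵐ x ∂μ, Tendsto (fun n => t n x) atTop (𝓝 (t₀ x)))
    (hξp : Tendsto (fun n => eLpNorm (ξ n - ξ₀) (ENNReal.ofReal p) μ) atTop (𝓝 0)) :
    Tendsto (fun n => eLpNorm (fun x => F x (t n x, ξ n x) - F x (t₀ x, ξ₀ x))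
      (ENNReal.ofReal r) μ) atTop (𝓝 0) := by
  have hM₀ : ∀ᵐ x ∂μ, |t₀ x| ≤ M := by
    filter_upwards [htt, ae_all_iff.2 hM] with x h1 h2
    exact le_of_tendsto h1.abs (Eventually.of_forall h2)
  -- Convergence in L^p gives a.e. convergence of ξ_n only along subsequences; this suffices,
  -- because every subsequence has a further one with the same limit 0.
  refine tendsto_of_subseq_tendsto fun ns hns => ?_
  obtain ⟨ms, hms, hms'⟩ := (tendstoInMeasure_of_tendsto_eLpNorm (by simpa using hp)
    (fun n => (hξ (ns n)).1) hξ₀.1 (hξp.comp hns)).exists_seq_tendsto_ae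
  refine ⟨ms, (tendsto_eLpNorm_ofReal_iff hr).2 ?_⟩
  have hlim := hns.comp hms.tendsto_atTop
  refine HasGrowth.tendsto_lintegral_of_ae hF hp hr hgr (t := fun n => t (ns (ms n)))
    (ξ := fun n => ξ (ns (ms n))) (fun n => ht _) ht₀ (fun n => hM _) hM₀ (fun n => hξ _) hξ₀ ?_
    hms' ?_
  · filter_upwards [htt] with x hx
    exact hx.comp hlim
  · exact (tendsto_eLpNorm_ofReal_iff hp).1 (hξp.comp hlim)

end Nemytskii

/-! ### Partial derivatives of A and its total derivative -/

section PartialDerivatives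

variable {N : ℕ} {A : Euc N → ℝ → Euc N → ℝ} {x : Euc N}

theorem partialT_eq_fderiv (h : ContDiff ℝ 1 (fun z : ℝ × Euc N => A x z.1 z.2))
    (z : ℝ × Euc N) :
    partialT A x z.1 z.2 = fderiv ℝ (fun z : ℝ × Euc N => A x z.1 z.2) z (1, 0) := by
  have h1 := (h.differentiable (by simp) z).hasFDerivAt
  have h2 : HasDerivAt (fun s : ℝ => (s, z.2)) (1, 0) z.1 :=
    (hasDerivAt_id z.1).prodMk (hasDerivAt_const _ _)
  exact (HasFDerivAt.comp_hasDerivAt (f := fun s : ℝ => (s, z.2)) z.1 h1 h2).deriv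

theorem gradXi_eq_toDual_symm (h : ContDiff ℝ 1 (fun z : ℝ × Euc N => A x z.1 z.2))
    (z : ℝ × Euc N) :
    gradXi A x z.1 z.2 = (InnerProductSpace.toDual ℝ (Euc N)).symm
      ((fderiv ℝ (fun z : ℝ × Euc N => A x z.1 z.2) z).comp
        (ContinuousLinearMap.inr ℝ ℝ (Euc N))) := by
  have h1 := (h.differentiable (by simp) z).hasFDerivAt
  have h2 : HasFDerivAt (fun η : Euc N => (z.1, η)) (ContinuousLinearMap.inr ℝ ℝ (Euc N)) z.2 :=
    hasFDerivAt_prodMk_right _ _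
  rw [gradXi, gradient]
  congr 1
  exact (HasFDerivAt.comp (f := fun η : Euc N => (z.1, η)) z.2 h1 h2).fderiv

theorem inner_gradXi (h : ContDiff ℝ 1 (fun z : ℝ × Euc N => A x z.1 z.2))
    (z : ℝ × Euc N) (η : Euc N) :
    inner ℝ (gradXi A x z.1 z.2) η
      = fderiv ℝ (fun z : ℝ × Euc N => A x z.1 z.2) z (0, η) := by
  rw [gradXi_eq_toDual_symm h, InnerProductSpace.toDual_symm_apply]
  simp

theorem fderiv_apply_eq_inner_gradXi_add
    (h : ContDiff ℝ 1 (fun z : ℝ × Euc N => A x z.1 z.2)) (z w : ℝ × Euc N) :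
    fderiv ℝ (fun z : ℝ × Euc N => A x z.1 z.2) z w
      = inner ℝ (gradXi A x z.1 z.2) w.2 + partialT A x z.1 z.2 * w.1 := by
  rw [inner_gradXi h, partialT_eq_fderiv h, mul_comm, ← smul_eq_mul, ← map_smul, ← map_add]
  simp

end PartialDerivatives

/-! ### Carathéodory property of A_t, a and G -/

section Caratheodory

variable {N : ℕ} {Ω : Set (Euc N)} {A : Euc N → ℝ → Euc N → ℝ} {g : Euc N → ℝ → ℝ}

theorem IsC1Caratheodory.caratheodoryMap (hA : IsC1Caratheodory Ω A) :
    CaratheodoryMap (volOn Ω) (fun x (z : ℝ × Euc N) => A x z.1 z.2) :=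
  ⟨fun z => (hA.measurable z.1 z.2).aestronglyMeasurable, hA.contDiff.mono fun _ h => h.continuous⟩

/-- A directional derivative is the a.e. limit of the quotients n(A(x, z + w/n) - A(x, z)), each
measurable in x. -/
theorem IsC1Caratheodory.aestronglyMeasurable_fderiv (hA : IsC1Caratheodory Ω A)
    (z w : ℝ × Euc N) :
    AEStronglyMeasurable (fun x => fderiv ℝ (fun z : ℝ × Euc N => A x z.1 z.2) z w)
      (volOn Ω) := by
  refine aestronglyMeasurable_of_tendsto_ae atTop
    (f := fun (n : ℕ) x => (n : ℝ) • (A x (z + (n : ℝ)⁻¹ • w).1 (z + (n : ℝ)⁻¹ • w).2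
      - A x z.1 z.2)) (fun n => ?_) ?_
  · exact ((hA.caratheodoryMap.measurable (z + (n : ℝ)⁻¹ • w)).sub
      (hA.caratheodoryMap.measurable z)).const_smul (n : ℝ)
  · filter_upwards [hA.contDiff] with x hx
    refine (hx.differentiable (by simp) z).hasFDerivAt.lim w ?_
    simpa using tendsto_natCast_atTop_atTop

theorem IsC1Caratheodory.caratheodoryMap_partialT (hA : IsC1Caratheodory Ω A) :
    CaratheodoryMap (volOn Ω) (fun x (z : ℝ × Euc N) => partialT A x z.1 z.2) := by
  refine ⟨fun z => (hA.aestronglyMeasurable_fderiv z (1, 0)).congr ?_, ?_⟩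
  · filter_upwards [hA.contDiff] with x hx
    rw [partialT_eq_fderiv hx]
  · filter_upwards [hA.contDiff] with x hx
    simp_rw [partialT_eq_fderiv hx]
    exact (hx.continuous_fderiv (by simp)).clm_apply continuous_const

/-- The coordinates of a in an orthonormal basis are directional derivatives, hence measurable;
continuity passes through the Riesz isometry. -/
theorem IsC1Caratheodory.caratheodoryMap_gradXi (hA : IsC1Caratheodory Ω A) :
    CaratheodoryMap (volOn Ω) (fun x (z : ℝ × Euc N) => gradXi A x z.1 z.2) := by
  let b := EuclideanSpace.basisFun (Fin N) ℝ
  refine ⟨fun z => ?_, ?_⟩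
  · have h : AEStronglyMeasurable (fun x => ∑ i, fderiv ℝ (fun z : ℝ × Euc N => A x z.1 z.2) z
        (0, b i) • b i) (volOn Ω) :=
      Finset.aestronglyMeasurable_fun_sum _ fun i _ =>
        (hA.aestronglyMeasurable_fderiv z (0, b i)).smul_const _
    refine h.congr ?_
    filter_upwards [hA.contDiff] with x hx
    rw [← b.sum_repr' (gradXi A x z.1 z.2)]
    refine Finset.sum_congr rfl fun i _ => ?_
    rw [real_inner_comm, inner_gradXi hx]
  · filter_upwards [hA.contDiff] with x hx
    simp_rw [gradXi_eq_toDual_symm hx]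
    exact (InnerProductSpace.toDual ℝ (Euc N)).symm.continuous.comp
      ((hx.continuous_fderiv (by simp)).clm_comp continuous_const)

theorem IsCaratheodory.caratheodoryMap (hg : IsCaratheodory Ω g) :
    CaratheodoryMap (volOn Ω) g :=
  ⟨fun t => (hg.measurable t).aestronglyMeasurable, hg.continuous⟩

theorem CaratheodoryMap.comp_continuous {α Z Z' β : Type*} [MeasurableSpace α] {μ : Measure α}
    [TopologicalSpace Z] [TopologicalSpace Z'] [TopologicalSpace β] {F : α → Z → β}
    (hF : CaratheodoryMap μ F) {f : Z' → Z} (hf : Continuous f) :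
    CaratheodoryMap μ (fun x z => F x (f z)) :=
  ⟨fun z => hF.measurable (f z), hF.continuous.mono fun _ h => h.comp hf⟩

theorem CaratheodoryMap.sub {α Z β : Type*} [MeasurableSpace α] {μ : Measure α}
    [TopologicalSpace Z] [NormedAddCommGroup β] {F G : α → Z → β}
    (hF : CaratheodoryMap μ F) (hG : CaratheodoryMap μ G) :
    CaratheodoryMap μ (fun x z => F x z - G x z) :=
  ⟨fun z => (hF.measurable z).sub (hG.measurable z), by
    filter_upwards [hF.continuous, hG.continuous] with x h1 h2 using h1.sub h2⟩

theorem hasDerivAt_primitiveG {x : Euc N} (h : Continuous (g x)) (t : ℝ) :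
    HasDerivAt (primitiveG g x) (g x t) t :=
  intervalIntegral.integral_hasDerivAt_right (h.intervalIntegrable _ _)
    (h.stronglyMeasurableAtFilter _ _) h.continuousAt

/-- Joint measurability of g comes from viewing it as a Carathéodory map over the product space and
inserting the second coordinate for t; Fubini then applies. -/
theorem IsCaratheodory.aestronglyMeasurable_setIntegral (hg : IsCaratheodory Ω g) (S : Set ℝ) :
    AEStronglyMeasurable (fun x => ∫ s in S, g x s) (volOn Ω) := by
  have h : CaratheodoryMap ((volOn Ω).prod (volume.restrict S))
      (fun (y : Euc N × ℝ) t => g y.1 t) :=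
    ⟨fun t => (hg.caratheodoryMap.measurable t).comp_fst,
      Measure.quasiMeasurePreserving_fst.ae hg.continuous⟩
  exact (h.comp_aestronglyMeasurable (w := Prod.snd)
    measurable_snd.aestronglyMeasurable).integral_prod_right'

theorem IsCaratheodory.caratheodoryMap_primitiveG (hg : IsCaratheodory Ω g) :
    CaratheodoryMap (volOn Ω) (primitiveG g) := by
  refine ⟨fun t => ?_, ?_⟩
  · simp_rw [primitiveG, intervalIntegral]
    exact (hg.aestronglyMeasurable_setIntegral _).sub (hg.aestronglyMeasurable_setIntegral _)
  · filter_upwards [hg.continuous] with x hx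
    exact continuous_iff_continuousAt.2 fun t => (hasDerivAt_primitiveG hx t).continuousAt

end Caratheodory

/-! ### Growth conditions on sets bounded in t -/

section Growth

variable {α E E' : Type*} [MeasurableSpace α] {μ : Measure α} [NormedAddCommGroup E]
  [NormedAddCommGroup E'] {p : ℝ}

theorem exists_bound_of_continuous {f : ℝ → ℝ} (hf : Continuous f) (M : ℝ) :
    ∃ K, 0 ≤ K ∧ ∀ t, |t| ≤ M → f t ≤ K := by
  obtain ⟨K, hK⟩ := (isCompact_Icc (a := -M) (b := M)).bddAbove_image hf.continuousOn
  exact ⟨max K 0, le_max_right _ _, fun t ht =>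
    (hK (Set.mem_image_of_mem f (abs_le.1 ht))).trans (le_max_left _ _)⟩

/-- For |t| ≤ M the continuous coefficients are bounded by constants. -/
theorem hasGrowth_one_of_bound {F : α → ℝ × E → E'} {Φ φ : ℝ → ℝ} (hΦ : Continuous Φ)
    (hφ : Continuous φ)
    (h : ∀ᵐ x ∂μ, ∀ (t : ℝ) (ξ : E), ‖F x (t, ξ)‖ ≤ Φ t + φ t * ‖ξ‖ ^ p) :
    HasGrowth μ F p 1 := by
  intro M
  obtain ⟨K, hK0, hK⟩ := exists_bound_of_continuous hΦ M
  obtain ⟨L, hL0, hL⟩ := exists_bound_of_continuous hφ M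
  refine ⟨K + L, by positivity, ?_⟩
  filter_upwards [h] with x hx t ξ ht
  have e : 0 ≤ ‖ξ‖ ^ p := by positivity
  rw [Real.rpow_one]
  nlinarith [hx t ξ, hK t ht, mul_le_mul_of_nonneg_right (hL t ht) e]

/-- The power p/(p-1) is chosen so that it turns |ξ|^{p-1} into |ξ|^p. -/
theorem hasGrowth_conj_of_bound (hp : 1 < p) {F : α → ℝ × E → E'} {Φ φ : ℝ → ℝ}
    (hΦ : Continuous Φ) (hφ : Continuous φ)
    (h : ∀ᵐ x ∂μ, ∀ (t : ℝ) (ξ : E), ‖F x (t, ξ)‖ ≤ Φ t + φ t * ‖ξ‖ ^ (p - 1)) :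
    HasGrowth μ F p (p / (p - 1)) := by
  intro M
  obtain ⟨K, hK0, hK⟩ := exists_bound_of_continuous hΦ M
  obtain ⟨L, hL0, hL⟩ := exists_bound_of_continuous hφ M
  have hp1 : 0 < p - 1 := by linarith
  have hr : 0 ≤ p / (p - 1) := by positivity
  refine ⟨2 ^ (p / (p - 1)) * (K ^ (p / (p - 1)) + L ^ (p / (p - 1))), by positivity, ?_⟩
  filter_upwards [h] with x hx t ξ ht
  have e : 0 ≤ ‖ξ‖ ^ (p - 1) := by positivity
  have e1 : ‖F x (t, ξ)‖ ≤ K + L * ‖ξ‖ ^ (p - 1) := by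
    nlinarith [hx t ξ, hK t ht, mul_le_mul_of_nonneg_right (hL t ht) e]
  refine (Real.rpow_le_rpow (norm_nonneg _) e1 hr).trans ?_
  refine (real_add_rpow_le hK0 (by positivity) hr).trans ?_
  rw [Real.mul_rpow hL0 e, ← Real.rpow_mul (norm_nonneg ξ), mul_div_cancel₀ p hp1.ne', mul_assoc]
  refine mul_le_mul_of_nonneg_left ?_ (by positivity)
  have e2 : 0 ≤ ‖ξ‖ ^ p := by positivity
  have e3 : 0 ≤ K ^ (p / (p - 1)) := by positivity
  have e4 : 0 ≤ L ^ (p / (p - 1)) := by positivity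
  nlinarith [mul_nonneg e3 e2]

/-- This brings g and G into the same framework: any continuous bound in t will do, so no
restriction on q arises. -/
theorem hasGrowth_one_of_bound_left {f : α → ℝ → E'} {Φ : ℝ → ℝ} (hΦ : Continuous Φ)
    (h : ∀ᵐ x ∂μ, ∀ t : ℝ, ‖f x t‖ ≤ Φ t) :
    HasGrowth μ (fun x (z : ℝ × E) => f x z.1) p 1 := by
  refine hasGrowth_one_of_bound hΦ (φ := fun _ => 0) continuous_const ?_
  filter_upwards [h] with x hx t ξ
  simpa using hx t

theorem HasGrowth.sub_one {F G : α → ℝ × E → E'} (hF : HasGrowth μ F p 1)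
    (hG : HasGrowth μ G p 1) : HasGrowth μ (fun x z => F x z - G x z) p 1 := by
  intro M
  obtain ⟨K, hK0, hK⟩ := hF M
  obtain ⟨L, hL0, hL⟩ := hG M
  refine ⟨K + L, by positivity, ?_⟩
  filter_upwards [hK, hL] with x h1 h2 t ξ ht
  have h3 := h1 t ξ ht
  have h4 := h2 t ξ ht
  rw [Real.rpow_one] at *
  linarith [norm_sub_le (F x (t, ξ)) (G x (t, ξ))]

end Growth

theorem abs_primitiveG_le {N : ℕ} {g : Euc N → ℝ → ℝ} {x : Euc N} {a₁ a₂ q : ℝ} (ha₂ : 0 ≤ a₂)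
    (hq : 1 ≤ q) (h : ∀ t : ℝ, |g x t| ≤ a₁ + a₂ * |t| ^ (q - 1)) (t : ℝ) :
    |primitiveG g x t| ≤ (a₁ + a₂ * |t| ^ (q - 1)) * |t| := by
  have := intervalIntegral.norm_integral_le_of_norm_le_const (a := 0) (b := t) (f := g x)
    (C := a₁ + a₂ * |t| ^ (q - 1)) ?_
  · simpa [primitiveG] using this
  · intro s hs
    refine (h s).trans ?_
    have hst : |s| ≤ |t| := by
      simpa using Set.abs_sub_left_of_mem_uIcc (Set.uIoc_subset_uIcc hs)
    gcongr

/-! ### The space X: gradient, value and evaluation -/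

noncomputable section

namespace spaceX

variable {N : ℕ} {Ω : Set (Euc N)} {p : ℝ} [Fact (1 < p)]

/-- The map `u ↦ ∇u` from `X` to `L^p`. -/
def gradCLM (Ω : Set (Euc N)) (p : ℝ) [Fact (1 < p)] :
    spaceX Ω p →L[ℝ] Lp (Euc N) (ENNReal.ofReal p) (volOn Ω) :=
  LinearMap.mkContinuous
    { toFun := grad
      map_add' := fun _ _ => rfl
      map_smul' := fun _ _ => rfl } 1 fun u => by
    rw [one_mul, norm_spaceX]
    exact le_add_of_nonneg_right (norm_nonneg _)

/-- The inclusion of `X` in `L^∞`. -/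
def valCLM (Ω : Set (Euc N)) (p : ℝ) [Fact (1 < p)] :
    spaceX Ω p →L[ℝ] Lp ℝ ⊤ (volOn Ω) :=
  LinearMap.mkContinuous
    { toFun := val
      map_add' := fun _ _ => rfl
      map_smul' := fun _ _ => rfl } 1 fun u => by
    rw [one_mul, norm_spaceX]
    exact le_add_of_nonneg_left (norm_nonneg _)

theorem gradCLM_apply (u : spaceX Ω p) : gradCLM Ω p u = grad u := rfl

theorem valCLM_apply (u : spaceX Ω p) : valCLM Ω p u = val u := rfl

theorem ae_abs_val_le (u : spaceX Ω p) : ∀ᵐ x ∂(volOn Ω), |val u x| ≤ normInfty u := by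
  have h := Lp.eLpNorm_lt_top (val u)
  filter_upwards [ae_le_eLpNormEssSup (f := val u) (μ := volOn Ω)] with x hx
  rw [normInfty, Lp.norm_def, ← Real.norm_eq_abs, ← toReal_enorm]
  refine ENNReal.toReal_mono h.ne ?_
  rwa [eLpNorm_exponent_top]

/-- The pair `(u, ∇u)`. -/
def pair (u : spaceX Ω p) (x : Euc N) : ℝ × Euc N := (val u x, grad u x)

/-- Elements of X are classes, so evaluation is linear only off a null set, which may depend on `s`.
-/
theorem pair_add_smul (u v : spaceX Ω p) (s : ℝ) :
    ∀ᵐ x ∂(volOn Ω), pair (u + s • v) x = pair u x + s • pair v x := by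
  filter_upwards [Lp.coeFn_add (val u) (s • val v), Lp.coeFn_smul s (val v),
    Lp.coeFn_add (grad u) (s • grad v), Lp.coeFn_smul s (grad v)] with x h1 h2 h3 h4
  refine Prod.ext ?_ ?_
  · change (val u + s • val v : Lp ℝ ⊤ (volOn Ω)) x = val u x + s • val v x
    rw [h1, Pi.add_apply, h2, Pi.smul_apply]
  · change (grad u + s • grad v : Lp (Euc N) (ENNReal.ofReal p) (volOn Ω)) x
      = grad u x + s • grad v x
    rw [h3, Pi.add_apply, h4, Pi.smul_apply]

theorem aestronglyMeasurable_val (u : spaceX Ω p) :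
    AEStronglyMeasurable (fun x => val u x) (volOn Ω) :=
  Lp.aestronglyMeasurable _

theorem aestronglyMeasurable_pair (u : spaceX Ω p) :
    AEStronglyMeasurable (pair u) (volOn Ω) :=
  (aestronglyMeasurable_val u).prodMk (Lp.aestronglyMeasurable _)

theorem memLp_grad (u : spaceX Ω p) :
    MemLp (fun x => grad u x) (ENNReal.ofReal p) (volOn Ω) := Lp.memLp _

end spaceX

/-! ### Superposition on X and the pairing with X' -/

theorem holderConjugate_ofReal {p : ℝ} (hp : 1 < p) :
    ENNReal.HolderConjugate (ENNReal.ofReal (p / (p - 1))) (ENNReal.ofReal p) :=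
  (((Real.holderConjugate_iff_eq_conjExponent hp).mpr rfl).symm).ennrealOfReal

theorem conj_pos {p : ℝ} (hp : 1 < p) : 0 < p / (p - 1) :=
  div_pos (zero_lt_one.trans hp) (sub_pos.2 hp)

theorem fact_one_le_conj {p : ℝ} (hp : 1 < p) : Fact (1 ≤ ENNReal.ofReal (p / (p - 1))) :=
  ⟨by
    rw [ENNReal.one_le_ofReal, le_div_iff₀ (by linarith)]
    linarith⟩

/-- Composition of a map with growth of order `p` with `(u, ∇u)`. -/
theorem HasGrowth.memLp_pair {N : ℕ} {Ω : Set (Euc N)} {p : ℝ} [hp : Fact (1 < p)]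
    [IsFiniteMeasure (volOn Ω)] {E' : Type*} [NormedAddCommGroup E']
    {F : Euc N → ℝ × Euc N → E'} (hF : CaratheodoryMap (volOn Ω) F) {r : ℝ} (hr : 0 < r)
    (hgr : HasGrowth (volOn Ω) F p r) (u : spaceX Ω p) :
    MemLp (fun x => F x (spaceX.pair u x)) (ENNReal.ofReal r) (volOn Ω) :=
  HasGrowth.memLp hF (zero_lt_one.trans hp.out) hr hgr (spaceX.aestronglyMeasurable_val u)
    (spaceX.ae_abs_val_le u) (spaceX.memLp_grad u)

theorem HasGrowth.tendsto_eLpNorm_pair {N : ℕ} {Ω : Set (Euc N)} {p : ℝ} [hp : Fact (1 < p)]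
    [IsFiniteMeasure (volOn Ω)] {E' : Type*} [NormedAddCommGroup E']
    {F : Euc N → ℝ × Euc N → E'} (hF : CaratheodoryMap (volOn Ω) F) {r : ℝ} (hr : 0 < r)
    (hgr : HasGrowth (volOn Ω) F p r) {u : ℕ → spaceX Ω p} {u₀ : spaceX Ω p}
    (hW : Tendsto (fun n => normW (u n - u₀)) atTop (𝓝 0))
    (hae : ∀ᵐ x ∂(volOn Ω), Tendsto (fun n => spaceX.val (u n) x) atTop (𝓝 (spaceX.val u₀ x)))
    {M : ℝ} (hM : ∀ n, normInfty (u n) ≤ M) :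
    Tendsto (fun n => eLpNorm ((fun x => F x (spaceX.pair (u n) x))
      - fun x => F x (spaceX.pair u₀ x)) (ENNReal.ofReal r) (volOn Ω)) atTop (𝓝 0) := by
  refine HasGrowth.tendsto_eLpNorm hF (zero_lt_one.trans hp.out) hr hgr
    (fun n => spaceX.aestronglyMeasurable_val (u n)) (spaceX.aestronglyMeasurable_val u₀) (M := M)
    (fun n => ?_) (fun n => spaceX.memLp_grad (u n)) (spaceX.memLp_grad u₀) hae ?_
  · filter_upwards [spaceX.ae_abs_val_le (u n)] with x hx using hx.trans (hM n)
  · refine (Lp.tendsto_Lp_iff_tendsto_eLpNorm' (fun n => spaceX.grad (u n))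
      (spaceX.grad u₀)).1 ?_
    exact tendsto_iff_norm_sub_tendsto_zero.2 hW

/-- The continuous functional on `X` with density `(f, b)`, that is
`v ↦ ∫ f · ∇v + ∫ b v`. -/
def pairing {N : ℕ} (Ω : Set (Euc N)) (p : ℝ) [hp : Fact (1 < p)]
    (f : Lp (Euc N) (ENNReal.ofReal (p / (p - 1))) (volOn Ω)) (b : Lp ℝ 1 (volOn Ω)) :
    spaceX Ω p →L[ℝ] ℝ :=
  haveI := holderConjugate_ofReal hp.out
  haveI := fact_one_le_conj hp.out
  ((innerSL ℝ (E := Euc N)).lpPairing (volOn Ω) _ _ f).comp (spaceX.gradCLM Ω p)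
    + ((ContinuousLinearMap.mul ℝ ℝ).lpPairing (volOn Ω) 1 ⊤ b).comp (spaceX.valCLM Ω p)

/-- Each summand is a bounded linear map of its density by Hölder's inequality, so convergence of
the densities gives convergence in the norm of X'. -/
theorem continuous_pairing {N : ℕ} (Ω : Set (Euc N)) (p : ℝ) [hp : Fact (1 < p)] :
    haveI := fact_one_le_conj hp.out
    Continuous (fun w : Lp (Euc N) (ENNReal.ofReal (p / (p - 1))) (volOn Ω) × Lp ℝ 1 (volOn Ω) =>
      pairing Ω p w.1 w.2) := by
  have := holderConjugate_ofReal hp.out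
  have := fact_one_le_conj hp.out
  unfold pairing
  fun_prop

theorem spaceX.integrable_mul_val {N : ℕ} {Ω : Set (Euc N)} {p : ℝ} [Fact (1 < p)]
    {f : Euc N → ℝ} (hf : Integrable f (volOn Ω)) (v : spaceX Ω p) :
    Integrable (fun x => f x * spaceX.val v x) (volOn Ω) :=
  hf.mul_bdd (c := normInfty v) (spaceX.aestronglyMeasurable_val v) (spaceX.ae_abs_val_le v)

/-- A function whose derivatives along lines are given by a continuous map into the dual is
Fréchet differentiable. -/
theorem hasFDerivAt_of_hasDerivAt_line {X : Type*} [NormedAddCommGroup X] [NormedSpace ℝ X]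
    {f : X → ℝ} {f' : X → X →L[ℝ] ℝ} (hf' : Continuous f')
    (hf : ∀ (u v : X) (s : ℝ), HasDerivAt (fun s : ℝ => f (u + s • v)) (f' (u + s • v) v) s)
    (u : X) : HasFDerivAt f (f' u) u := by
  rw [hasFDerivAt_iff_isLittleO_nhds_zero, Asymptotics.isLittleO_iff]
  intro ε hε
  obtain ⟨δ, hδ, hδ'⟩ := Metric.continuousAt_iff.1 (hf'.continuousAt (x := u)) ε hε
  filter_upwards [Metric.ball_mem_nhds (0 : X) hδ] with v hv
  have hd := hf u v
  -- The mean value theorem on [0, 1] gives f(u + v) - f(u) = f'(u + sv)v. The remainder is (f'(u +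
  -- sv) - f'(u))v, small because ‖sv‖ ≤ ‖v‖ < δ.
  obtain ⟨s, hs, hs'⟩ := exists_hasDerivAt_eq_slope _ _ one_pos
    (fun s _ => (hd s).continuousAt.continuousWithinAt) (fun s _ => hd s)
  simp only [one_smul, zero_smul, add_zero, sub_zero, div_one] at hs'
  rw [← hs', ← _root_.sub_apply]
  refine (ContinuousLinearMap.le_opNorm _ _).trans ?_
  gcongr
  rw [← dist_eq_norm]
  refine (hδ' ?_).le
  rw [dist_eq_norm, add_sub_cancel_left, norm_smul, Real.norm_of_nonneg hs.1.le]
  rw [mem_ball_zero_iff] at hv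
  nlinarith [norm_nonneg v, hs.2]

/-- An integrand `H(x, t, ξ)` with partial derivatives `B` in `t` and `a` in `ξ`, all of them
Carathéodory maps with the growth natural for the exponent `p`. -/
structure IsEnergyDensity {N : ℕ} (Ω : Set (Euc N)) (p : ℝ) (H B : Euc N → ℝ × Euc N → ℝ)
    (a : Euc N → ℝ × Euc N → Euc N) : Prop where
  carath : CaratheodoryMap (volOn Ω) H
  carath_t : CaratheodoryMap (volOn Ω) B
  carath_xi : CaratheodoryMap (volOn Ω) a
  growth : HasGrowth (volOn Ω) H p 1
  growth_t : HasGrowth (volOn Ω) B p 1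
  growth_xi : HasGrowth (volOn Ω) a p (p / (p - 1))
  hasDerivAt : ∀ᵐ x ∂(volOn Ω), ∀ (z w : ℝ × Euc N) (s : ℝ),
    HasDerivAt (fun s : ℝ => H x (z + s • w))
      (inner ℝ (a x (z + s • w)) w.2 + B x (z + s • w) * w.1) s

/-! ### Continuity and differentiability of integral functionals -/

namespace IsEnergyDensity

open spaceX

variable {N : ℕ} {Ω : Set (Euc N)} {p : ℝ} [hp : Fact (1 < p)] [IsFiniteMeasure (volOn Ω)]
  {H B : Euc N → ℝ × Euc N → ℝ} {a : Euc N → ℝ × Euc N → Euc N}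

theorem integrable (h : IsEnergyDensity Ω p H B a) (u : spaceX Ω p) :
    Integrable (fun x => H x (pair u x)) (volOn Ω) := by
  have := HasGrowth.memLp_pair h.carath one_pos h.growth u
  rwa [ENNReal.ofReal_one, memLp_one_iff_integrable] at this

theorem memLp_t (h : IsEnergyDensity Ω p H B a) (u : spaceX Ω p) :
    MemLp (fun x => B x (pair u x)) 1 (volOn Ω) := by
  have := HasGrowth.memLp_pair h.carath_t one_pos h.growth_t u
  rwa [ENNReal.ofReal_one] at this

theorem memLp_xi (h : IsEnergyDensity Ω p H B a) (u : spaceX Ω p) :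
    MemLp (fun x => a x (pair u x)) (ENNReal.ofReal (p / (p - 1))) (volOn Ω) :=
  HasGrowth.memLp_pair h.carath_xi (conj_pos hp.out) h.growth_xi u

theorem integrable_inner (h : IsEnergyDensity Ω p H B a) (u v : spaceX Ω p) :
    Integrable (fun x => (inner ℝ (a x (pair u x)) (grad v x) : ℝ)) (volOn Ω) := by
  have := holderConjugate_ofReal hp.out
  exact memLp_one_iff_integrable.1
    ((innerSL ℝ (E := Euc N)).memLp_of_bilin 1 (h.memLp_xi u) (memLp_grad v))

theorem integrable_mul (h : IsEnergyDensity Ω p H B a) (u v : spaceX Ω p) :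
    Integrable (fun x => B x (pair u x) * val v x) (volOn Ω) :=
  spaceX.integrable_mul_val (memLp_one_iff_integrable.1 (h.memLp_t u)) v

/-- The differential `v ↦ ∫ a(x, u, ∇u) · ∇v + ∫ B(x, u, ∇u) v`. -/
def differential (h : IsEnergyDensity Ω p H B a) (u : spaceX Ω p) : spaceX Ω p →L[ℝ] ℝ :=
  pairing Ω p ((h.memLp_xi u).toLp _) ((h.memLp_t u).toLp _)

theorem differential_apply (h : IsEnergyDensity Ω p H B a) (u v : spaceX Ω p) :
    h.differential u v = ∫ x, (inner ℝ (a x (pair u x)) (grad v x)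
      + B x (pair u x) * val v x) ∂(volOn Ω) := by
  have := holderConjugate_ofReal hp.out
  have := fact_one_le_conj hp.out
  rw [integral_add (h.integrable_inner u v) (h.integrable_mul u v)]
  simp only [differential, pairing, _root_.add_apply, ContinuousLinearMap.comp_apply,
    ContinuousLinearMap.lpPairing_eq_integral, gradCLM_apply, valCLM_apply]
  congr 1
  · refine integral_congr_ae ?_
    filter_upwards [(h.memLp_xi u).coeFn_toLp] with x hx
    rw [hx]
    rfl
  · refine integral_congr_ae ?_
    filter_upwards [(h.memLp_t u).coeFn_toLp] with x hx
    rw [hx]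
    rfl

section Convergence

variable {u : ℕ → spaceX Ω p} {u₀ : spaceX Ω p} {M : ℝ}

/-- The densities converge in L^{p/(p-1)} and L^1 by Nemytskii continuity, and `continuous_pairing`
transfers this to X'. -/
theorem tendsto_differential (h : IsEnergyDensity Ω p H B a)
    (hW : Tendsto (fun n => normW (u n - u₀)) atTop (𝓝 0))
    (hae : ∀ᵐ x ∂(volOn Ω), Tendsto (fun n => val (u n) x) atTop (𝓝 (val u₀ x)))
    (hM : ∀ n, normInfty (u n) ≤ M) :
    Tendsto (fun n => h.differential (u n)) atTop (𝓝 (h.differential u₀)) := by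
  have := fact_one_le_conj hp.out
  have h1 := HasGrowth.tendsto_eLpNorm_pair h.carath_xi (conj_pos hp.out) h.growth_xi hW hae hM
  have h2 := HasGrowth.tendsto_eLpNorm_pair h.carath_t one_pos h.growth_t hW hae hM
  rw [ENNReal.ofReal_one] at h2
  have h3 := (Lp.tendsto_Lp_iff_tendsto_eLpNorm'' _ (fun n => h.memLp_xi (u n)) _
    (h.memLp_xi u₀)).2 h1
  have h4 := (Lp.tendsto_Lp_iff_tendsto_eLpNorm'' _ (fun n => h.memLp_t (u n)) _
    (h.memLp_t u₀)).2 h2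
  have h5 := ((continuous_pairing Ω p).tendsto ((h.memLp_xi u₀).toLp _, (h.memLp_t u₀).toLp _)).comp
    (h3.prodMk_nhds h4)
  exact h5

theorem tendsto_integral (h : IsEnergyDensity Ω p H B a)
    (hW : Tendsto (fun n => normW (u n - u₀)) atTop (𝓝 0))
    (hae : ∀ᵐ x ∂(volOn Ω), Tendsto (fun n => val (u n) x) atTop (𝓝 (val u₀ x)))
    (hM : ∀ n, normInfty (u n) ≤ M) :
    Tendsto (fun n => ∫ x, H x (pair (u n) x) ∂(volOn Ω)) atTop
      (𝓝 (∫ x, H x (pair u₀ x) ∂(volOn Ω))) := by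
  have h1 := HasGrowth.tendsto_eLpNorm_pair h.carath one_pos h.growth hW hae hM
  rw [ENNReal.ofReal_one] at h1
  exact tendsto_integral_of_L1' _ (h.integrable u₀).1
    (Eventually.of_forall fun n => h.integrable (u n)) h1

end Convergence

/-- Convergence in X implies the hypotheses of `tendsto_differential`: L^∞ convergence yields
boundedness and, off a countable union of null sets, pointwise convergence. -/
theorem continuous_differential (h : IsEnergyDensity Ω p H B a) :
    Continuous h.differential := by
  refine continuous_iff_seqContinuous.2 fun u u₀ hu => ?_
  have hW : Tendsto (fun n => normW (u n - u₀)) atTop (𝓝 0) :=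
    tendsto_iff_norm_sub_tendsto_zero.1 (((gradCLM Ω p).continuous.tendsto u₀).comp hu)
  have hI : Tendsto (fun n => normInfty (u n - u₀)) atTop (𝓝 0) :=
    tendsto_iff_norm_sub_tendsto_zero.1 (((valCLM Ω p).continuous.tendsto u₀).comp hu)
  have hae : ∀ᵐ x ∂(volOn Ω), Tendsto (fun n => val (u n) x) atTop (𝓝 (val u₀ x)) := by
    filter_upwards [ae_all_iff.2 fun n => ae_abs_val_le (u n - u₀),
      ae_all_iff.2 fun n => Lp.coeFn_sub (val (u n)) (val u₀)] with x h1 h2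
    refine tendsto_iff_norm_sub_tendsto_zero.2
      (squeeze_zero (fun _ => norm_nonneg _) (fun n => ?_) hI)
    rw [← Pi.sub_apply (val (u n) : Euc N → ℝ), ← h2 n]
    exact h1 n
  obtain ⟨M, hM⟩ := (((valCLM Ω p).continuous.tendsto u₀).comp hu).norm.bddAbove_range
  exact h.tendsto_differential hW hae fun n => hM (Set.mem_range_self n)

/-- Young's inequality with its factors dropped; it isolates |a|^{p/(p-1)}, the quantity that the
growth condition controls. -/
theorem norm_inner_le_of_rpow_le {E : Type*} [NormedAddCommGroup E] [InnerProductSpace ℝ E]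
    {p : ℝ} (hp : 1 < p) (y η : E) :
    ‖(inner ℝ y η : ℝ)‖ ≤ ‖y‖ ^ (p / (p - 1)) + ‖η‖ ^ p := by
  have hc : (p / (p - 1)).HolderConjugate p :=
    ((Real.holderConjugate_iff_eq_conjExponent hp).mpr rfl).symm
  refine (norm_inner_le_norm y η).trans
    ((Real.young_inequality_of_nonneg (norm_nonneg _) (norm_nonneg _) hc).trans ?_)
  exact add_le_add (div_le_self (by positivity) hc.lt.le) (div_le_self (by positivity) hp.le)

theorem hasDerivAt_integral_line (h : IsEnergyDensity Ω p H B a) (u v : spaceX Ω p) (s₀ : ℝ) :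
    HasDerivAt (fun s : ℝ => ∫ x, H x (pair (u + s • v) x) ∂(volOn Ω))
      (h.differential (u + s₀ • v) v) s₀ := by
  have hp0 : 0 < p := zero_lt_one.trans hp.out
  -- `c` bounds |s| on the unit ball around s₀; there |u + sv| ≤ M a.e. and |∇u + s∇v| ≤ |∇u| +
  -- c|∇v|, uniformly in s.
  set c : ℝ := |s₀| + 1 with hc
  have hc0 : 0 ≤ c := by positivity
  set M : ℝ := normInfty u + c * normInfty v with hM
  obtain ⟨K, hK0, hK⟩ := h.growth_t M
  obtain ⟨L, hL0, hL⟩ := h.growth_xi M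
  have hw : MemLp (fun x => ‖grad u x‖ + c * ‖grad v x‖) (ENNReal.ofReal p) (volOn Ω) :=
    (memLp_grad u).norm.add ((memLp_grad v).norm.const_mul c)
  have hv : Integrable (fun x => ‖grad v x‖ ^ p) (volOn Ω) := by
    have := (memLp_grad v).integrable_norm_rpow (by simpa using hp0) ENNReal.ofReal_ne_top
    rwa [ENNReal.toReal_ofReal hp0.le] at this
  have hpair : ∀ s : ℝ, AEStronglyMeasurable (fun x => pair u x + s • pair v x) (volOn Ω) :=
    fun s => (aestronglyMeasurable_pair u).add ((aestronglyMeasurable_pair v).const_smul s)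
  -- Differentiation under the integral needs one null set for all s. The explicit representatives u
  -- + sv, ∇u + s∇v provide it, while the class of u + sv agrees with them for each s separately.
  have hJ : ∀ s : ℝ, (fun x => H x (pair (u + s • v) x))
      =ᵐ[volOn Ω] fun x => H x (pair u x + s • pair v x) := fun s => by
    filter_upwards [pair_add_smul u v s] with x hx
    rw [hx]
  have hmain := (hasDerivAt_integral_of_dominated_loc_of_deriv_le (μ := volOn Ω)
    (F := fun (s : ℝ) x => H x (pair u x + s • pair v x))
    (F' := fun (s : ℝ) x => inner ℝ (a x (pair u x + s • pair v x)) (grad v x)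
      + B x (pair u x + s • pair v x) * val v x)
    -- The first two terms bound a · ∇v by Young and the growth of a; the last bounds Bv, with |v|
    -- at most its L^∞ norm.
    (bound := fun x => L * (1 + ‖‖grad u x‖ + c * ‖grad v x‖‖ ^ p) + ‖grad v x‖ ^ p
      + (K * normInfty v) * (1 + ‖‖grad u x‖ + c * ‖grad v x‖‖ ^ p))
    (x₀ := s₀) (s := Metric.ball s₀ 1) (Metric.ball_mem_nhds _ one_pos)
    (Eventually.of_forall fun s => h.carath.comp_aestronglyMeasurable (hpair s))
    ((h.integrable (u + s₀ • v)).congr (hJ s₀))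
    (((h.carath_xi.comp_aestronglyMeasurable (hpair s₀)).inner (memLp_grad v).1).add
      ((h.carath_t.comp_aestronglyMeasurable (hpair s₀)).mul (aestronglyMeasurable_val v)))
    ?_ (((integrable_one_add_norm_rpow hp0 hw L).add hv).add
      (integrable_one_add_norm_rpow hp0 hw _)) ?_).2
  · rw [h.differential_apply]
    have e : ∫ x, (inner ℝ (a x (pair (u + s₀ • v) x)) (grad v x)
        + B x (pair (u + s₀ • v) x) * val v x) ∂(volOn Ω)
        = ∫ x, (inner ℝ (a x (pair u x + s₀ • pair v x)) (grad v x)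
        + B x (pair u x + s₀ • pair v x) * val v x) ∂(volOn Ω) := by
      refine integral_congr_ae ?_
      filter_upwards [pair_add_smul u v s₀] with x hx
      rw [hx]
    rw [e]
    refine hmain.congr_of_eventuallyEq (Eventually.of_forall fun s => ?_)
    exact integral_congr_ae (hJ s)
  · filter_upwards [hK, hL, ae_abs_val_le u, ae_abs_val_le v] with x h1 h2 h3 h4 s hs
    have hs' : |s| ≤ c := by
      rw [Metric.mem_ball, Real.dist_eq] at hs
      have := abs_sub_abs_le_abs_sub s s₀
      rw [hc]
      linarith
    have ht : |val u x + s * val v x| ≤ M := by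
      refine (abs_add_le _ _).trans ?_
      rw [abs_mul]
      exact add_le_add h3 (mul_le_mul hs' h4 (abs_nonneg _) hc0)
    have hξ : ‖grad u x + s • grad v x‖ ^ p ≤ ‖‖grad u x‖ + c * ‖grad v x‖‖ ^ p := by
      refine Real.rpow_le_rpow (norm_nonneg _) ?_ hp0.le
      rw [Real.norm_of_nonneg (by positivity)]
      refine (norm_add_le _ _).trans ?_
      rw [norm_smul, Real.norm_eq_abs]
      gcongr
    have h1' := h1 (val u x + s * val v x) (grad u x + s • grad v x) ht
    have h2' := h2 (val u x + s * val v x) (grad u x + s • grad v x) ht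
    rw [Real.rpow_one] at h1'
    have hz : pair u x + s • pair v x = (val u x + s * val v x, grad u x + s • grad v x) := rfl
    rw [hz]
    refine (norm_add_le _ _).trans (add_le_add ?_ ?_)
    · refine (norm_inner_le_of_rpow_le hp.out _ _).trans (add_le_add_left (h2'.trans ?_) _)
      gcongr
    · rw [norm_mul, mul_right_comm]
      refine mul_le_mul (h1'.trans ?_) h4 (norm_nonneg _) (by positivity)
      gcongr
  · filter_upwards [h.hasDerivAt] with x hx s _
    exact hx (pair u x) (pair v x) s

theorem hasFDerivAt_integral (h : IsEnergyDensity Ω p H B a) (u : spaceX Ω p) :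
    HasFDerivAt (fun u : spaceX Ω p => ∫ x, H x (pair u x) ∂(volOn Ω)) (h.differential u) u :=
  hasFDerivAt_of_hasDerivAt_line h.continuous_differential h.hasDerivAt_integral_line u

theorem contDiff_integral (h : IsEnergyDensity Ω p H B a) :
    ContDiff ℝ 1 (fun u : spaceX Ω p => ∫ x, H x (pair u x) ∂(volOn Ω)) :=
  contDiff_one_iff_hasFDerivAt.2
    ⟨h.differential, h.continuous_differential, h.hasFDerivAt_integral⟩

end IsEnergyDensity

end

/-! ### The functional J -/

theorem primitiveG_bound_continuous {a₁ a₂ q : ℝ} (hq : 1 ≤ q) :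
    Continuous (fun t : ℝ => (a₁ + a₂ * |t| ^ (q - 1)) * |t|) := by
  have : Continuous (fun t : ℝ => |t| ^ (q - 1)) :=
    continuous_abs.rpow_const fun _ => Or.inr (by linarith)
  fun_prop

theorem hasDerivAt_line_sub_primitiveG {N : ℕ} {A : Euc N → ℝ → Euc N → ℝ} {g : Euc N → ℝ → ℝ}
    {x : Euc N} (hA : ContDiff ℝ 1 (fun z : ℝ × Euc N => A x z.1 z.2)) (hg : Continuous (g x))
    (z w : ℝ × Euc N) (s : ℝ) :
    HasDerivAt (fun s : ℝ => A x (z + s • w).1 (z + s • w).2 - primitiveG g x (z + s • w).1)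
      (inner ℝ (gradXi A x (z + s • w).1 (z + s • w).2) w.2
        + (partialT A x (z + s • w).1 (z + s • w).2 - g x (z + s • w).1) * w.1) s := by
  have hl : HasDerivAt (fun s : ℝ => z + s • w) w s := by
    simpa using ((hasDerivAt_id s).smul_const w).const_add z
  have hl1 : HasDerivAt (fun s : ℝ => (z + s • w).1) w.1 s := by
    simpa using ((hasDerivAt_id s).mul_const w.1).const_add z.1
  have h1 := (hA.differentiable (by simp) (z + s • w)).hasFDerivAt.comp_hasDerivAt s hl
  rw [fderiv_apply_eq_inner_gradXi_add hA] at h1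
  have h2 := (hasDerivAt_primitiveG hg (z + s • w).1).comp s hl1
  convert! h1.sub h2 using 1
  ring

theorem tendsto_norm_sub_clm_zero {X ι : Type*} [NormedAddCommGroup X] [NormedSpace ℝ X]
    {l : Filter ι} {f : ι → X →L[ℝ] ℝ} {f₀ : X →L[ℝ] ℝ} (h : Tendsto f l (𝓝 f₀)) :
    Tendsto (fun i => ‖f i - f₀‖) l (𝓝 0) :=
  tendsto_iff_norm_sub_tendsto_zero.1 h

theorem proposition3 {N : ℕ} (hN : 2 ≤ N) (Ω : Set (Euc N)) (hΩ : IsOpen Ω)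
    (hΩb : Bornology.IsBounded Ω) (p : ℝ) [Fact (1 < p)]
    (A : Euc N → ℝ → Euc N → ℝ) (g : Euc N → ℝ → ℝ)
    (hA : IsC1Caratheodory Ω A)
    (Φ₀ φ₀ Φ₁ φ₁ Φ₂ φ₂ : ℝ → ℝ)
    (hΦ₀ : Continuous Φ₀ ∧ ∀ t, 0 < Φ₀ t) (hφ₀ : Continuous φ₀ ∧ ∀ t, 0 < φ₀ t)
    (hΦ₁ : Continuous Φ₁ ∧ ∀ t, 0 < Φ₁ t) (hφ₁ : Continuous φ₁ ∧ ∀ t, 0 < φ₁ t)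
    (hΦ₂ : Continuous Φ₂ ∧ ∀ t, 0 < Φ₂ t) (hφ₂ : Continuous φ₂ ∧ ∀ t, 0 < φ₂ t)
    (hA₀ : ∀ᵐ x ∂(volOn Ω), ∀ (t : ℝ) (ξ : Euc N), |A x t ξ| ≤ Φ₀ t + φ₀ t * ‖ξ‖ ^ p)
    (hA₁ : ∀ᵐ x ∂(volOn Ω), ∀ (t : ℝ) (ξ : Euc N),
      |partialT A x t ξ| ≤ Φ₁ t + φ₁ t * ‖ξ‖ ^ p)
    (hA₂ : ∀ᵐ x ∂(volOn Ω), ∀ (t : ℝ) (ξ : Euc N),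
      ‖gradXi A x t ξ‖ ≤ Φ₂ t + φ₂ t * ‖ξ‖ ^ (p - 1))
    (hg : IsCaratheodory Ω g)
    (a₁ a₂ q : ℝ) (ha₁ : 0 < a₁) (ha₂ : 0 < a₂) (hq : 1 ≤ q)
    (hg₁ : ∀ᵐ x ∂(volOn Ω), ∀ t : ℝ, |g x t| ≤ a₁ + a₂ * |t| ^ (q - 1)) :
    -- all the integrals in `J(u)` and `⟨dJ(u), v⟩` converge
    (∀ u v : spaceX Ω p,
      Integrable (fun x => A x (spaceX.val u x) (spaceX.grad u x)) (volOn Ω) ∧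
      Integrable (fun x => primitiveG g x (spaceX.val u x)) (volOn Ω) ∧
      Integrable (fun x => (inner ℝ (gradXi A x (spaceX.val u x) (spaceX.grad u x))
        (spaceX.grad v x) : ℝ)) (volOn Ω) ∧
      Integrable (fun x => partialT A x (spaceX.val u x) (spaceX.grad u x) * spaceX.val v x)
        (volOn Ω) ∧
      Integrable (fun x => g x (spaceX.val u x) * spaceX.val v x) (volOn Ω)) ∧
    ∃ dJ : spaceX Ω p → (spaceX Ω p →L[ℝ] ℝ),
      (∀ u v : spaceX Ω p, dJ u v = differentialJ A g u v) ∧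
      (∀ (u : ℕ → spaceX Ω p) (u₀ : spaceX Ω p),
        Tendsto (fun n => normW (u n - u₀)) atTop (𝓝 0) →
        (∀ᵐ x ∂(volOn Ω), Tendsto (fun n => spaceX.val (u n) x) atTop (𝓝 (spaceX.val u₀ x))) →
        (∃ M : ℝ, 0 < M ∧ ∀ n, normInfty (u n) ≤ M) →
        Tendsto (fun n => functionalJ A g (u n)) atTop (𝓝 (functionalJ A g u₀)) ∧
        Tendsto (fun n => ‖dJ (u n) - dJ u₀‖) atTop (𝓝 0)) ∧
      (∀ u : spaceX Ω p, HasFDerivAt (functionalJ A g : spaceX Ω p → ℝ) (dJ u) u) ∧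
      ContDiff ℝ 1 (functionalJ A g : spaceX Ω p → ℝ) := by
  have hp : 1 < p := Fact.out
  have hfin : IsFiniteMeasure (volOn Ω) := ⟨by
    rw [Measure.restrict_apply_univ]
    exact hΩb.measure_lt_top⟩
  have gA : HasGrowth (volOn Ω) (fun x (z : ℝ × Euc N) => A x z.1 z.2) p 1 :=
    hasGrowth_one_of_bound hΦ₀.1 hφ₀.1 hA₀
  have gAt : HasGrowth (volOn Ω) (fun x (z : ℝ × Euc N) => partialT A x z.1 z.2) p 1 :=
    hasGrowth_one_of_bound hΦ₁.1 hφ₁.1 hA₁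
  have ga : HasGrowth (volOn Ω) (fun x (z : ℝ × Euc N) => gradXi A x z.1 z.2) p (p / (p - 1)) :=
    hasGrowth_conj_of_bound hp hΦ₂.1 hφ₂.1 hA₂
  have gg : HasGrowth (volOn Ω) (fun x (z : ℝ × Euc N) => g x z.1) p 1 := by
    refine hasGrowth_one_of_bound_left (Φ := fun t => a₁ + a₂ * |t| ^ (q - 1)) ?_ hg₁
    have : Continuous (fun t : ℝ => |t| ^ (q - 1)) :=
      continuous_abs.rpow_const fun _ => Or.inr (by linarith)
    fun_prop
  have gG : HasGrowth (volOn Ω) (fun x (z : ℝ × Euc N) => primitiveG g x z.1) p 1 := by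
    refine hasGrowth_one_of_bound_left (primitiveG_bound_continuous (a₁ := a₁) (a₂ := a₂) hq) ?_
    filter_upwards [hg₁] with x hx t
    exact abs_primitiveG_le ha₂.le hq hx t
  have cA := hA.caratheodoryMap
  have cAt := hA.caratheodoryMap_partialT
  have cg : CaratheodoryMap (volOn Ω) (fun x (z : ℝ × Euc N) => g x z.1) :=
    hg.caratheodoryMap.comp_continuous continuous_fst
  have cG : CaratheodoryMap (volOn Ω) (fun x (z : ℝ × Euc N) => primitiveG g x z.1) :=
    hg.caratheodoryMap_primitiveG.comp_continuous continuous_fst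
  -- Absorbing G into the density lets the general results treat `J` as a single integral.
  have h : IsEnergyDensity Ω p (fun x z => A x z.1 z.2 - primitiveG g x z.1)
      (fun x z => partialT A x z.1 z.2 - g x z.1) (fun x z => gradXi A x z.1 z.2) :=
    { carath := cA.sub cG
      carath_t := cAt.sub cg
      carath_xi := hA.caratheodoryMap_gradXi
      growth := gA.sub_one gG
      growth_t := gAt.sub_one gg
      growth_xi := ga
      hasDerivAt := by
        filter_upwards [hA.contDiff, hg.continuous] with x h1 h2 z w s
        exact hasDerivAt_line_sub_primitiveG h1 h2 z w s }
  have iof : ∀ {F : Euc N → ℝ × Euc N → ℝ}, CaratheodoryMap (volOn Ω) F →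
      HasGrowth (volOn Ω) F p 1 → ∀ u : spaceX Ω p,
      Integrable (fun x => F x (spaceX.pair u x)) (volOn Ω) := fun hF hgr u => by
    have := HasGrowth.memLp_pair hF one_pos hgr u
    rwa [ENNReal.ofReal_one, memLp_one_iff_integrable] at this
  -- The two integrals merge because each integrand is integrable on its own.
  have hJ : (functionalJ A g : spaceX Ω p → ℝ) = fun u => ∫ x, (A x (spaceX.pair u x).1
      (spaceX.pair u x).2 - primitiveG g x (spaceX.pair u x).1) ∂(volOn Ω) := by
    funext u
    exact (integral_sub (iof cA gA u) (iof cG gG u)).symm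
  refine ⟨fun u v => ⟨iof cA gA u, iof cG gG u, h.integrable_inner u v,
    spaceX.integrable_mul_val (iof cAt gAt u) v,
    spaceX.integrable_mul_val (iof cg gg u) v⟩, h.differential, ?_, ?_, ?_, ?_⟩
  · intro u v
    have i1 := spaceX.integrable_mul_val (iof cAt gAt u) v
    have i2 := spaceX.integrable_mul_val (iof cg gg u) v
    rw [h.differential_apply, differentialJ]
    refine Eq.trans ?_ (integral_sub ((h.integrable_inner u v).add i1) i2)
    refine integral_congr_ae (Eventually.of_forall fun x => ?_)
    simp only [spaceX.pair]
    ring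
  · rintro u u₀ hW hae ⟨M, -, hM⟩
    refine ⟨?_, tendsto_norm_sub_clm_zero (h.tendsto_differential hW hae hM)⟩
    rw [hJ]
    exact h.tendsto_integral hW hae hM
  · intro u
    rw [hJ]
    exact h.hasFDerivAt_integral u
  · rw [hJ]
    exact h.contDiff_integral
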